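/- Let $\Omega$ be a first-order signature containing a functional symbol of arity at least $2$, and let $\mathcal C$ be the class of all models of $\Omega$ (nonempty $\Omega$-structures). Write $\mathfrak A\sqsupseteq\mathfrak B$ if $\mathfrak A$ contains $\mathfrak B$ as a submodel. Let $L$ be a model-theoretic language based on $\Omega$: a collection $L_s$ of sentences with a satisfaction relation $\vDash$ between models of $\Omega$ and sentences which is preserved under isomorphisms, such that $L$ includes first-order logic $L_{\omega,\omega}$ (with equality) over $\Omega$ and $L_s$ is closed under the Boolean connectives. Assume that $L$ expresses the $\sqsupseteq$-satisfiability on $\mathcal C$, i.e., that there is $f:L_s\to L_s$ such that for all $\varphi\in L_s$ and $\mathfrak A\in\mathcal C$, $$\mathfrak A\vDash f(\varphi)\iff\exists\,\mathfrak B\in\mathcal C\ (\mathfrak A\sqsupseteq\mathfrak B\ \text{ and }\ \mathfrak B\vDash\varphi).$$ Modal formulas are built from countably many propositional variables by $\bot,\to,\Diamond$, with $\Box=\neg\Diamond\neg$. The modal theory $\mathrm{MTh}^L(\mathcal C,\sqsupseteq)$ is the set of all modal formulas $\alpha$ such that $[\alpha]$ holds in every model in $\mathcal C$ for every map $[\,\cdot\,]$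 from propositional variables to $L_s$, extended to modal formulas by $[\bot]=\bot$, $[\alpha\to\beta]=[\alpha]\to[\beta]$, $[\Diamond\alpha]=f([\alpha])$ (it does not depend on the choice of such an $f$). Then $$\mathrm{MTh}^L(\mathcal C,\sqsupseteq)=\begin{cases}\mathrm{S4}&\text{if $\Omega$ has no constant symbols},\\ \mathrm{S4.2.1}&\text{otherwise.}\end{cases}$$ Here a normal modal logic is a set of modal formulas that contains all classical tautologies, $\neg\Diamond\bot$ and $\Diamond(p\vee q)\to\Diamond p\vee\Diamond q$, and is closed under modus ponens, substitution, and monotonicity (from $\alpha\to\beta$ infer $\Diamond\alpha\to\Diamond\beta$); $\mathrm{S4}$ is the smallest normal modal logic containing $\Diamond\Diamond p\to\Diamond p$ and $p\to\Diamond p$; and $\mathrm{S4.2.1}$ is the smallest normal modal logic that includes $\mathrm{S4}$ and contains $\Box\Diamond p\leftrightarrow\Diamond\Box p$. -/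

import Mathlib

/-! Modal theories of relations between models: modal logics, model-theoretic languages, and the
submodel relation. -/

universe u v w s

/-- Propositional modal formulas over the countable set `ℕ` of variables, with basic connectives
`⊥`, `→`, `◇`. -/
inductive ModalFormula : Type where
  | var : ℕ → ModalFormula
  | bot : ModalFormula
  | imp : ModalFormula → ModalFormula → ModalFormula
  | dia : ModalFormula → ModalFormula

namespace ModalFormula

def neg (a : ModalFormula) : ModalFormula := imp a bot

def or (a b : ModalFormula) : ModalFormula := imp (neg a) b

def and (a b : ModalFormula) : ModalFormula := neg (imp a (neg b))

def iff (a b : ModalFormula) : ModalFormula := and (imp a b) (imp b a)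

def box (a : ModalFormula) : ModalFormula := neg (dia (neg a))

/-- Uniform substitution of formulas for variables. -/
def subst (σ : ℕ → ModalFormula) : ModalFormula → ModalFormula
  | var n => σ n
  | bot => bot
  | imp a b => imp (subst σ a) (subst σ b)
  | dia a => dia (subst σ a)

/-- Classical tautologies: true under every assignment of truth values that respects `⊥` and `→`
(formulas `◇ a` count as atoms). -/
def IsTautology (a : ModalFormula) : Prop :=
  ∀ v : ModalFormula → Prop, ¬ v bot → (∀ b c, v (imp b c) ↔ (v b → v c)) → v a

end ModalFormula

open ModalFormula in
/-- Normal (propositional, unimodal) logics. -/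
structure IsNormalLogic (Λ : Set ModalFormula) : Prop where
  tautology : ∀ a, IsTautology a → a ∈ Λ
  dia_bot : neg (dia bot) ∈ Λ
  dia_or : imp (dia (or (var 0) (var 1))) (or (dia (var 0)) (dia (var 1))) ∈ Λ
  modus_ponens : ∀ a b, a ∈ Λ → imp a b ∈ Λ → b ∈ Λ
  substitution : ∀ a, a ∈ Λ → ∀ σ : ℕ → ModalFormula, subst σ a ∈ Λ
  monotonicity : ∀ a b, imp a b ∈ Λ → imp (dia a) (dia b) ∈ Λ

/-- The smallest normal logic that includes `Γ`. -/
def leastNormalLogic (Γ : Set ModalFormula) : Set ModalFormula :=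
  ⋂₀ {Λ | IsNormalLogic Λ ∧ Γ ⊆ Λ}

open ModalFormula in
/-- `S4`: the smallest normal logic containing `◇◇p → ◇p` and `p → ◇p`. -/
def logicS4 : Set ModalFormula :=
  leastNormalLogic {imp (dia (dia (var 0))) (dia (var 0)), imp (var 0) (dia (var 0))}

open ModalFormula in
/-- `S4.2.1 = S4 + (□◇p ↔ ◇□p)`. -/
def logicS421 : Set ModalFormula :=
  leastNormalLogic (logicS4 ∪ {iff (box (dia (var 0))) (dia (box (var 0)))})

open FirstOrder in
/-- The models of the signature `Ω` (with universe in `Type w`): nonempty `Ω`-structures. -/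
abbrev SigModel (Ω : FirstOrder.Language.{u, v}) : Type (max u v (w + 1)) :=
  FirstOrder.Language.Theory.ModelType.{u, v, w} (∅ : Ω.Theory)

open FirstOrder in
/-- A model-theoretic language `L = L(Ω)` based on the signature `Ω`, given by its sentences and its
satisfaction relation: satisfaction is preserved under isomorphisms, `L` includes first-order logic
(with equality), and the sentences of `L` are closed under implication, hence, together with the
first-order `⊥`, under all Boolean connectives. -/
structure ModelTheoreticLanguage (Ω : FirstOrder.Language.{u, v}) where
  Sent : Type s
  Sat : SigModel.{u, v, w} Ω → Sent → Prop
  sat_of_equiv : ∀ (A B : SigModel.{u, v, w} Ω), (A ≃[Ω] B) → ∀ φ : Sent, Sat A φ → Sat B φ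
  ofFirstOrder : Ω.Sentence → Sent
  sat_ofFirstOrder : ∀ (A : SigModel.{u, v, w} Ω) (φ : Ω.Sentence), Sat A (ofFirstOrder φ) ↔ A ⊨ φ
  imp : Sent → Sent → Sent
  sat_imp : ∀ (A : SigModel.{u, v, w} Ω) (φ ψ : Sent), Sat A (imp φ ψ) ↔ (Sat A φ → Sat A ψ)

namespace ModelTheoreticLanguage

/-- The sentence `⊥` of `L`. -/
def bot {Ω : FirstOrder.Language.{u, v}} (L : ModelTheoreticLanguage.{u, v, w, s} Ω) : L.Sent :=
  L.ofFirstOrder ⊥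

/-- The `L`-theory of a class of models. -/
def theoryOf {Ω : FirstOrder.Language.{u, v}} (L : ModelTheoreticLanguage.{u, v, w, s} Ω)
    (C : Set (SigModel.{u, v, w} Ω)) : Set L.Sent :=
  {φ | ∀ A ∈ C, L.Sat A φ}

/-- The extension to all modal formulas of a valuation of the variables in the sentences of `L`,
where `◇` is interpreted by the operation `f` on sentences. -/
def extend {Ω : FirstOrder.Language.{u, v}} (L : ModelTheoreticLanguage.{u, v, w, s} Ω)
    (f : L.Sent → L.Sent) (θ : ℕ → L.Sent) : ModalFormula → L.Sent
  | .var n => θ n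
  | .bot => L.bot
  | .imp a b => L.imp (L.extend f θ a) (L.extend f θ b)
  | .dia a => f (L.extend f θ a)

/-- The modal theory `MTh(T, f)` of the operation `f` on the set of sentences `T`. -/
def modalTheory {Ω : FirstOrder.Language.{u, v}} (L : ModelTheoreticLanguage.{u, v, w, s} Ω)
    (T : Set L.Sent) (f : L.Sent → L.Sent) : Set ModalFormula :=
  {a | ∀ θ : ℕ → L.Sent, L.extend f θ a ∈ T}

/-- The operation `f` expresses the `R`-satisfiability on the class `C`. -/
def Expresses {Ω : FirstOrder.Language.{u, v}} (L : ModelTheoreticLanguage.{u, v, w, s} Ω)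
    (f : L.Sent → L.Sent) (C : Set (SigModel.{u, v, w} Ω))
    (R : SigModel.{u, v, w} Ω → SigModel.{u, v, w} Ω → Prop) : Prop :=
  ∀ (φ : L.Sent), ∀ A ∈ C, (L.Sat A (f φ) ↔ ∃ B ∈ C, R A B ∧ L.Sat B φ)

end ModelTheoreticLanguage

open FirstOrder in
/-- `A ⊒ B`: the model `A` contains `B` as a submodel. Universes of models are types, so `B` is
identified with a substructure of `A` along an isomorphism. -/
def ContainsSubmodel {Ω : FirstOrder.Language.{u, v}} (A B : SigModel.{u, v, w} Ω) : Prop :=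
  ∃ S : Ω.Substructure A, Nonempty (B ≃[Ω] S)

/-! The theory contains `S4` because `⊒` is a preorder, and it contains `S4.2.1` if there are
constants, because then each model has a least submodel, the one generated by the constants.

Conversely, a formula outside the logic fails at a point of the canonical model. Unraveling from
this point makes it fail at the root of a Kripke model on the tree `ℕ^{<ω}`; if there are constants,
the tree is extended by an endpoint, which stands for the final point that `□◇p ↔ ◇□p` provides in
the canonical model. The function symbol of arity at least `2` can be interpreted by a
multiplication on the tree for which the submodels are exactly the cones. This multiplication has
room for an arbitrary labeling of the nodes by sets of numbers, and a first-order sentence reads off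
from a cone whether its root is labeled by `j`. Hence the cones, ordered by `⊒`, with suitable
values of the variables, form the given Kripke model on the tree. -/

/-! ### Propositional theories -/

namespace ModalFormula

/-- An injective coding of formulas by natural numbers, which makes `ModalFormula` countable. -/
def toNat : ModalFormula → ℕ
  | var n => 4 * n
  | bot => 1
  | imp a b => 4 * Nat.pair (toNat a) (toNat b) + 2
  | dia a => 4 * toNat a + 3

theorem toNat_injective : Function.Injective toNat := by
  intro a
  induction a <;> intro b h <;> cases b <;> grind [toNat, Nat.pair_eq_pair]

instance : Countable ModalFormula := toNat_injective.countable

/-- The truth sets of the Boolean valuations of formulas, in which `◇ a` counts as an atom. -/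
structure IsBoolean (m : Set ModalFormula) : Prop where
  bot_notMem : bot ∉ m
  imp_mem_iff : ∀ {a b}, imp a b ∈ m ↔ (a ∈ m → b ∈ m)

theorem isTautology_iff {a : ModalFormula} : IsTautology a ↔ ∀ m, IsBoolean m → a ∈ m :=
  ⟨fun h m hm => h (· ∈ m) hm.bot_notMem fun _ _ => hm.imp_mem_iff,
    fun h v hbot himp => h {b | v b} ⟨hbot, himp _ _⟩⟩

variable {a b c : ModalFormula} {m n T : Set ModalFormula}

namespace IsBoolean

theorem neg_mem_iff (hm : IsBoolean m) : neg a ∈ m ↔ a ∉ m := by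
  simp only [neg, hm.imp_mem_iff, hm.bot_notMem, imp_false]

theorem or_mem_iff (hm : IsBoolean m) : or a b ∈ m ↔ a ∈ m ∨ b ∈ m := by
  rw [ModalFormula.or, hm.imp_mem_iff, hm.neg_mem_iff, or_iff_not_imp_left]

theorem iff_mem_iff (hm : IsBoolean m) : iff a b ∈ m ↔ (a ∈ m ↔ b ∈ m) := by
  simp only [ModalFormula.iff, ModalFormula.and, hm.neg_mem_iff, hm.imp_mem_iff]
  tauto

theorem box_mem_iff (hm : IsBoolean m) : box a ∈ m ↔ dia (neg a) ∉ m :=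
  hm.neg_mem_iff

theorem eq_of_subset (hm : IsBoolean m) (hn : IsBoolean n) (h : m ⊆ n) : m = n := by
  refine h.antisymm fun a ha => ?_
  by_contra ham
  exact hn.neg_mem_iff.1 (h (hm.neg_mem_iff.2 ham)) ha

end IsBoolean

/-- Propositional theories: sets of formulas closed under classical propositional derivability. -/
structure IsTheory (T : Set ModalFormula) : Prop where
  tautology : ∀ a, IsTautology a → a ∈ T
  modus_ponens : ∀ a b, a ∈ T → imp a b ∈ T → b ∈ T

namespace IsTheory

theorem mem_of_forall_isBoolean (hT : IsTheory T) (h : ∀ m, IsBoolean m → a ∈ m) : a ∈ T :=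
  hT.tautology a (isTautology_iff.2 h)

theorem mem_of_entails (hT : IsTheory T) (ha : a ∈ T) (hb : b ∈ T)
    (h : ∀ m, IsBoolean m → a ∈ m → b ∈ m → c ∈ m) : c ∈ T := by
  refine hT.modus_ponens _ _ hb <| hT.modus_ponens _ _ ha <|
    hT.mem_of_forall_isBoolean fun m hm => ?_
  exact hm.imp_mem_iff.2 fun ha => hm.imp_mem_iff.2 (h m hm ha)

theorem imp_mem_of_mem (hT : IsTheory T) (hb : b ∈ T) : imp a b ∈ T :=
  hT.mem_of_entails hb hb fun _ hm hb _ => hm.imp_mem_iff.2 fun _ => hb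

theorem setOf_imp_mem (hT : IsTheory T) (b : ModalFormula) : IsTheory {c | imp b c ∈ T} where
  tautology _ hc := hT.imp_mem_of_mem (hT.tautology _ hc)
  modus_ponens c d hc hcd := hT.mem_of_entails hc hcd fun m hm => by
    simp only [hm.imp_mem_iff]
    tauto

theorem sUnion {𝒞 : Set (Set ModalFormula)} (h𝒞 : ∀ T ∈ 𝒞, IsTheory T)
    (hchain : IsChain (· ⊆ ·) 𝒞) (hne : 𝒞.Nonempty) : IsTheory (⋃₀ 𝒞) where
  tautology a ha := hne.imp fun T hT => ⟨hT, (h𝒞 T hT).tautology a ha⟩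
  modus_ponens a b := by
    rintro ⟨T, hT, ha⟩ ⟨U, hU, hab⟩
    obtain ⟨V, hV, hTV, hUV⟩ := hchain.directedOn T hT U hU
    exact ⟨V, hV, (h𝒞 V hV).modus_ponens a b (hTV ha) (hUV hab)⟩

theorem isBoolean (hT : IsTheory T) (hneg : ∀ a, neg a ∈ T ↔ a ∉ T) : IsBoolean T where
  bot_notMem := (hneg bot).1 <| hT.mem_of_forall_isBoolean fun _ hm =>
    hm.neg_mem_iff.2 hm.bot_notMem
  imp_mem_iff {a b} := by
    refine ⟨fun hab ha => hT.modus_ponens a b ha hab, fun h => ?_⟩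
    by_cases ha : a ∈ T
    · exact hT.imp_mem_of_mem (h ha)
    · have hna := (hneg a).2 ha
      exact hT.mem_of_entails hna hna fun _ hm hna _ =>
        hm.imp_mem_iff.2 fun ha => absurd ha (hm.neg_mem_iff.1 hna)

theorem isBoolean_of_maximal (hT : Maximal (fun U => IsTheory U ∧ a ∉ U) T) : IsBoolean T := by
  obtain ⟨hTheory, ha⟩ := hT.prop
  have imp_mem : ∀ b, b ∉ T → imp b a ∈ T := fun b hb => by
    by_contra hba
    have hle : T ⊆ {c | imp b c ∈ T} := fun c hc => hTheory.imp_mem_of_mem hc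
    exact hb (hT.le_of_ge ⟨hTheory.setOf_imp_mem b, hba⟩ hle <|
      hTheory.mem_of_forall_isBoolean fun m hm => hm.imp_mem_iff.2 id)
  refine hTheory.isBoolean fun b => ⟨fun hnb hb => ha ?_, fun hb => ?_⟩
  · exact hTheory.mem_of_entails hnb hb fun _ hm hnb hb => absurd hb (hm.neg_mem_iff.1 hnb)
  · by_contra hnb
    refine ha (hTheory.mem_of_entails (imp_mem _ hb) (imp_mem _ hnb) fun m hm => ?_)
    simp only [hm.imp_mem_iff, hm.neg_mem_iff]
    tauto

theorem exists_isBoolean_of_notMem (hT : IsTheory T) (ha : a ∉ T) :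
    ∃ m, IsBoolean m ∧ T ⊆ m ∧ a ∉ m := by
  obtain ⟨m, hTm, hm⟩ := zorn_subset_nonempty {U | IsTheory U ∧ a ∉ U}
    (fun 𝒞 h𝒞 hchain hne => ⟨⋃₀ 𝒞, ⟨sUnion (fun U hU => (h𝒞 hU).1) hchain hne,
      fun ⟨U, hU, haU⟩ => (h𝒞 hU).2 haU⟩, fun _ => Set.subset_sUnion_of_mem⟩) T ⟨hT, ha⟩
  exact ⟨m, isBoolean_of_maximal hm, hTm, hm.prop.2⟩

end IsTheory

end ModalFormula

open ModalFormula

/-! ### Kripke models -/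

/-- A Kripke model for propositional modal formulas: an accessibility relation and a valuation of
the variables. -/
structure KripkeModel (W : Type*) where
  rel : W → W → Prop
  val : ℕ → W → Prop

namespace KripkeModel

variable {W W' : Type*} {M : KripkeModel W} {N : KripkeModel W'} {w k : W} {a b : ModalFormula}

/-- Kripke semantics: the truth of a modal formula at a point. -/
def Holds (M : KripkeModel W) : W → ModalFormula → Prop
  | w, .var n => M.val n w
  | _, .bot => False
  | w, .imp a b => M.Holds w a → M.Holds w b
  | w, .dia a => ∃ v, M.rel w v ∧ M.Holds v a

theorem isBoolean_setOf_holds (M : KripkeModel W) (w : W) : IsBoolean {a | M.Holds w a} :=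
  ⟨id, Iff.rfl⟩

theorem holds_or : M.Holds w (or a b) ↔ M.Holds w a ∨ M.Holds w b :=
  (M.isBoolean_setOf_holds w).or_mem_iff

theorem holds_iff : M.Holds w (iff a b) ↔ (M.Holds w a ↔ M.Holds w b) :=
  (M.isBoolean_setOf_holds w).iff_mem_iff

theorem holds_box : M.Holds w (box a) ↔ ∀ v, M.rel w v → M.Holds v a := by
  simp [box, neg, Holds]

theorem holds_iff_box_dia_dia_box (hwk : M.rel w k) (hk : ∀ v, M.rel w v → M.rel v k)
    (hfinal : ∀ v, M.rel k v → (M.Holds v a ↔ M.Holds k a)) :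
    M.Holds w (iff (box (dia a)) (dia (box a))) := by
  simp only [holds_iff, holds_box, Holds]
  constructor
  · intro h
    obtain ⟨v, hkv, hv⟩ := h k hwk
    exact ⟨k, hwk, fun u hku => (hfinal u hku).2 ((hfinal v hkv).1 hv)⟩
  · rintro ⟨v, hwv, hv⟩ u hwu
    exact ⟨k, hk u hwu, hv k (hk v hwv)⟩

/-- Bisimulations between Kripke models. -/
structure IsBisimulation (M : KripkeModel W) (N : KripkeModel W') (Z : W → W' → Prop) : Prop where
  val_iff : ∀ {w w'}, Z w w' → ∀ n, M.val n w ↔ N.val n w'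
  forth : ∀ {w w' v}, Z w w' → M.rel w v → ∃ v', N.rel w' v' ∧ Z v v'
  back : ∀ {w w' v'}, Z w w' → N.rel w' v' → ∃ v, M.rel w v ∧ Z v v'

theorem IsBisimulation.holds_iff {Z : W → W' → Prop} (hZ : IsBisimulation M N Z) {w : W} {w' : W'}
    (h : Z w w') (a : ModalFormula) : M.Holds w a ↔ N.Holds w' a := by
  induction a generalizing w w' with
  | var n => exact hZ.val_iff h n
  | bot => exact Iff.rfl
  | imp a b iha ihb => exact imp_congr (iha h) (ihb h)
  | dia a ih =>
    constructor
    · rintro ⟨v, hwv, hv⟩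
      obtain ⟨v', hwv', h'⟩ := hZ.forth h hwv
      exact ⟨v', hwv', (ih h').1 hv⟩
    · rintro ⟨v', hwv', hv'⟩
      obtain ⟨v, hwv, h'⟩ := hZ.back h hwv'
      exact ⟨v, hwv, (ih h').2 hv'⟩

/-- The node `i :: x` of the unraveling witnesses `◇ a` at the node `x`, where `a` is the `i`-th
formula of an enumeration. -/
theorem exists_unraveling (M : KripkeModel W) [IsPreorder W M.rel] (w : W) :
    ∃ t : List ℕ → W, t [] = w ∧ (∀ x y, x <:+ y → M.rel (t x) (t y)) ∧
      ∀ x a, M.Holds (t x) (dia a) → ∃ i, M.Holds (t (i :: x)) a := by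
  have : Nonempty ModalFormula := ⟨bot⟩
  obtain ⟨e, he⟩ := exists_surjective_nat ModalFormula
  have hstep (i : ℕ) (v : W) :
      ∃ v', M.rel v v' ∧ (M.Holds v (dia (e i)) → M.Holds v' (e i)) := by
    by_cases h : M.Holds v (dia (e i))
    · obtain ⟨v', hvv', hv'⟩ := h
      exact ⟨v', hvv', fun _ => hv'⟩
    · exact ⟨v, refl v, fun h' => absurd h' h⟩
  choose step hrel hholds using hstep
  refine ⟨List.foldr step w, rfl, ?_, fun x a ha => ?_⟩
  · rintro x _ ⟨z, rfl⟩
    induction z with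
    | nil => exact refl _
    | cons i z ih => exact _root_.trans ih (hrel i _)
  · obtain ⟨i, rfl⟩ := he a
    exact ⟨i, hholds i _ ha⟩

end KripkeModel

/-- Accessibility in the tree `ℕ^{<ω}` of finite sequences, in which a sequence sees the sequences
of which it is a suffix, extended by a reflexive endpoint `none`, which the sequences see if and
only if `c` holds. -/
def treeRel (c : Prop) : Option (List ℕ) → Option (List ℕ) → Prop
  | some x, some y => x <:+ y
  | some _, none => c
  | none, some _ => False
  | none, none => True

/-- The Kripke model on the tree with the relation `treeRel c`. -/
def treeModel (c : Prop) (V : ℕ → Option (List ℕ) → Prop) : KripkeModel (Option (List ℕ)) :=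
  ⟨treeRel c, V⟩

section treeRel

variable {c : Prop} {p q r : Option (List ℕ)}

theorem treeRel_refl : ∀ p, treeRel c p p
  | some _ => List.suffix_rfl
  | none => trivial

theorem treeRel_trans (hpq : treeRel c p q) (hqr : treeRel c q r) : treeRel c p r :=
  match p, q, r, hpq, hqr with
  | some _, some _, some _, hpq, hqr => hpq.trans hqr
  | some _, some _, none, _, hqr => hqr
  | some _, none, none, hpq, _ => hpq
  | none, none, none, _, _ => trivial

theorem treeRel_none (hc : c) : ∀ p, treeRel c p none
  | some _ => hc
  | none => trivial

theorem treeRel_none_left : ∀ {q}, treeRel c none q ↔ q = none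
  | some _ => iff_of_false id (Option.some_ne_none _)
  | none => iff_of_true trivial rfl

end treeRel

/-- Truth at a point of a Kripke model on a preorder is truth at the root of a tree model, where the
endpoint of the tree unravels a final point above everything that is seen. -/
theorem KripkeModel.exists_treeModel_holds_iff {W : Type*} (M : KripkeModel W) [IsPreorder W M.rel]
    {c : Prop} (w : W)
    (hc : c → ∃ k, (∀ v, M.rel w v → M.rel v k) ∧ ∀ v, M.rel k v → v = k) :
    ∃ V, ∀ a, (treeModel c V).Holds (some []) a ↔ M.Holds w a := by
  obtain ⟨k, hk⟩ : ∃ k, c → (∀ v, M.rel w v → M.rel v k) ∧ ∀ v, M.rel k v → v = k := by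
    by_cases h : c
    · exact (hc h).imp fun _ hk _ => hk
    · exact ⟨w, fun h' => absurd h' h⟩
  obtain ⟨t, rfl, ht, hdia⟩ := M.exists_unraveling w
  let g : Option (List ℕ) → W := fun p => p.elim k t
  have hrel : ∀ {p q}, treeRel c (some []) p → treeRel c p q → M.rel (g p) (g q)
    | some x, some y, _, hxy => ht x y hxy
    | some x, none, _, h => (hk h).1 _ (ht [] x x.nil_suffix)
    | none, none, _, _ => refl k
  have hdia' : ∀ {p a}, treeRel c (some []) p → M.Holds (g p) (dia a) →
      ∃ q, treeRel c p q ∧ M.Holds (g q) a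
    | some x, a, _, h => (hdia x a h).imp' (fun i => some (i :: x)) fun i hi =>
        ⟨List.suffix_cons i x, hi⟩
    | none, a, hp, ⟨v, hkv, hv⟩ => ⟨none, trivial, by rwa [(hk hp).2 v hkv] at hv⟩
  refine ⟨fun n p => M.val n (g p), fun a => ?_⟩
  suffices ∀ p, treeRel c (some []) p → ((treeModel c _).Holds p a ↔ M.Holds (g p) a) from
    this _ (treeRel_refl _)
  induction a with
  | var n => exact fun p _ => Iff.rfl
  | bot => exact fun p _ => Iff.rfl
  | imp a b iha ihb => exact fun p hp => imp_congr (iha p hp) (ihb p hp)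
  | dia a ih =>
    refine fun p hp => ⟨?_, fun h => ?_⟩
    · rintro ⟨q, hpq, hq⟩
      exact ⟨g q, hrel hp hpq, (ih q (treeRel_trans hp hpq)).1 hq⟩
    · obtain ⟨q, hpq, hq⟩ := hdia' hp h
      exact ⟨q, hpq, (ih q (treeRel_trans hp hpq)).2 hq⟩

/-! ### Completeness of normal logics above `S4` -/

theorem subset_leastNormalLogic (Γ : Set ModalFormula) : Γ ⊆ leastNormalLogic Γ :=
  Set.subset_sInter fun _ h => h.2

theorem leastNormalLogic_subset {Γ Λ : Set ModalFormula} (hΛ : IsNormalLogic Λ) (h : Γ ⊆ Λ) :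
    leastNormalLogic Γ ⊆ Λ :=
  Set.sInter_subset_of_mem ⟨hΛ, h⟩

theorem isNormalLogic_leastNormalLogic (Γ : Set ModalFormula) :
    IsNormalLogic (leastNormalLogic Γ) where
  tautology a ha := fun _ h => h.1.tautology a ha
  dia_bot := fun _ h => h.1.dia_bot
  dia_or := fun _ h => h.1.dia_or
  modus_ponens a b ha hab := fun Λ h => h.1.modus_ponens a b (ha Λ h) (hab Λ h)
  substitution a ha σ := fun Λ h => h.1.substitution a (ha Λ h) σ
  monotonicity a b hab := fun Λ h => h.1.monotonicity a b (hab Λ h)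

theorem logicS4_subset_logicS421 : logicS4 ⊆ logicS421 :=
  Set.subset_union_left.trans (subset_leastNormalLogic _)

namespace IsNormalLogic

variable {Λ : Set ModalFormula}

theorem isTheory (hΛ : IsNormalLogic Λ) : IsTheory Λ :=
  ⟨hΛ.tautology, hΛ.modus_ponens⟩

theorem dia_or_mem (hΛ : IsNormalLogic Λ) (a b : ModalFormula) :
    imp (dia (or a b)) (or (dia a) (dia b)) ∈ Λ :=
  hΛ.substitution _ hΛ.dia_or fun n => if n = 0 then a else b

theorem imp_dia_mem (hΛ : IsNormalLogic Λ) (hS4 : logicS4 ⊆ Λ) (a : ModalFormula) :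
    imp a (dia a) ∈ Λ :=
  hΛ.substitution _ (hS4 (subset_leastNormalLogic _ (Or.inr rfl))) fun _ => a

theorem dia_dia_imp_dia_mem (hΛ : IsNormalLogic Λ) (hS4 : logicS4 ⊆ Λ) (a : ModalFormula) :
    imp (dia (dia a)) (dia a) ∈ Λ :=
  hΛ.substitution _ (hS4 (subset_leastNormalLogic _ (Or.inl rfl))) fun _ => a

theorem iff_box_dia_dia_box_mem (hΛ : IsNormalLogic Λ) (hS421 : logicS421 ⊆ Λ) (a : ModalFormula) :
    iff (box (dia a)) (dia (box a)) ∈ Λ :=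
  hΛ.substitution _ (hS421 (subset_leastNormalLogic _ (Or.inr rfl))) fun _ => a

end IsNormalLogic

/-- The maximal consistent extensions of `Λ`, which are the points of its canonical model. -/
def CanonicalPoint (Λ : Set ModalFormula) : Type :=
  {m : Set ModalFormula // IsBoolean m ∧ Λ ⊆ m}

namespace CanonicalPoint

variable {Λ : Set ModalFormula} {m n : CanonicalPoint Λ} {a b c : ModalFormula}

instance : Membership ModalFormula (CanonicalPoint Λ) :=
  ⟨fun m a => a ∈ m.1⟩

theorem isBoolean (m : CanonicalPoint Λ) : IsBoolean {a | a ∈ m} :=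
  m.2.1

theorem mem_of_mem (m : CanonicalPoint Λ) (ha : a ∈ Λ) : a ∈ m :=
  m.2.2 ha

theorem neg_mem_iff : neg a ∈ m ↔ a ∉ m :=
  m.isBoolean.neg_mem_iff

theorem imp_mem_iff : imp a b ∈ m ↔ (a ∈ m → b ∈ m) :=
  m.isBoolean.imp_mem_iff

theorem mem_of_imp_mem (hab : imp a b ∈ Λ) (ha : a ∈ m) : b ∈ m :=
  imp_mem_iff.1 (m.mem_of_mem hab) ha

theorem eq_of_forall_mem (h : ∀ a ∈ m, a ∈ n) : m = n :=
  Subtype.ext (m.isBoolean.eq_of_subset n.isBoolean h)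

end CanonicalPoint

namespace IsNormalLogic

variable {Λ : Set ModalFormula} {m : CanonicalPoint Λ} {a b c : ModalFormula}

theorem mem_iff_forall_canonicalPoint (hΛ : IsNormalLogic Λ) :
    a ∈ Λ ↔ ∀ m : CanonicalPoint Λ, a ∈ m := by
  refine ⟨fun ha m => m.mem_of_mem ha, fun h => ?_⟩
  by_contra ha
  obtain ⟨m, hm, hΛm, ham⟩ := hΛ.isTheory.exists_isBoolean_of_notMem ha
  exact ham (h ⟨m, hm, hΛm⟩)

theorem imp_dia_dia_mem (hΛ : IsNormalLogic Λ) (h : ∀ n : CanonicalPoint Λ, a ∈ n → b ∈ n) :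
    imp (dia a) (dia b) ∈ Λ :=
  hΛ.monotonicity a b <| hΛ.mem_iff_forall_canonicalPoint.2 fun n =>
    CanonicalPoint.imp_mem_iff.2 (h n)

theorem dia_mem_mono (hΛ : IsNormalLogic Λ) (h : ∀ n : CanonicalPoint Λ, a ∈ n → b ∈ n)
    (ha : dia a ∈ m) : dia b ∈ m :=
  CanonicalPoint.mem_of_imp_mem (hΛ.imp_dia_dia_mem h) ha

theorem dia_mem_or (hΛ : IsNormalLogic Λ)
    (h : ∀ n : CanonicalPoint Λ, c ∈ n → a ∈ n ∨ b ∈ n) (hc : dia c ∈ m) :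
    dia a ∈ m ∨ dia b ∈ m := by
  have hab : dia (or a b) ∈ m := hΛ.dia_mem_mono (fun n hn => n.isBoolean.or_mem_iff.2 (h n hn)) hc
  exact m.isBoolean.or_mem_iff.1 (CanonicalPoint.mem_of_imp_mem (hΛ.dia_or_mem a b) hab)

theorem box_mem_of_forall (hΛ : IsNormalLogic Λ) (h : ∀ n : CanonicalPoint Λ, a ∈ n) :
    box a ∈ m := by
  refine m.isBoolean.box_mem_iff.2 fun ha => ?_
  have hbot : dia bot ∈ m :=
    hΛ.dia_mem_mono (fun n hna => absurd (h n) (CanonicalPoint.neg_mem_iff.1 hna)) ha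
  exact CanonicalPoint.neg_mem_iff.1 (m.mem_of_mem hΛ.dia_bot) hbot

theorem isTheory_setOf_box_mem (hΛ : IsNormalLogic Λ) (m : CanonicalPoint Λ) :
    IsTheory {a | box a ∈ m} where
  tautology a ha := hΛ.box_mem_of_forall fun n => n.mem_of_mem (hΛ.tautology a ha)
  modus_ponens a b ha hab := by
    refine m.isBoolean.box_mem_iff.2 fun hb => ?_
    have hor : dia (neg a) ∈ m ∨ dia (neg (imp a b)) ∈ m := hΛ.dia_mem_or (fun n => by
      simp only [CanonicalPoint.neg_mem_iff, CanonicalPoint.imp_mem_iff]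
      tauto) hb
    exact hor.elim (m.isBoolean.box_mem_iff.1 ha) (m.isBoolean.box_mem_iff.1 hab)

end IsNormalLogic

/-- The canonical model of `Λ`, in which `m` sees `n` if `◇ a` is in `m` for every `a` in `n`. -/
def canonicalModel (Λ : Set ModalFormula) : KripkeModel (CanonicalPoint Λ) where
  rel m n := ∀ a ∈ n, dia a ∈ m
  val i m := var i ∈ m

namespace CanonicalPoint

variable {Λ : Set ModalFormula} {m n : CanonicalPoint Λ} {a : ModalFormula}

theorem mem_of_rel_of_box_mem (hmn : (canonicalModel Λ).rel m n) (ha : box a ∈ m) : a ∈ n := by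
  by_contra han
  exact m.isBoolean.box_mem_iff.1 ha (hmn _ (neg_mem_iff.2 han))

theorem exists_rel_of_dia_mem (hΛ : IsNormalLogic Λ) (ha : dia a ∈ m) :
    ∃ n, (canonicalModel Λ).rel m n ∧ a ∈ n := by
  have hna : neg a ∉ {b | box b ∈ m} := fun h =>
    m.isBoolean.box_mem_iff.1 h <| hΛ.dia_mem_mono (fun n hn => by
      simpa only [neg_mem_iff, not_not] using hn) ha
  obtain ⟨n, hn, hmn, han⟩ := (hΛ.isTheory_setOf_box_mem m).exists_isBoolean_of_notMem hna
  refine ⟨⟨n, hn, fun b hb => hmn (hΛ.box_mem_of_forall fun k => k.mem_of_mem hb)⟩, ?_, ?_⟩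
  · intro b hb
    by_contra hbm
    refine hn.neg_mem_iff.1 (hmn (m.isBoolean.box_mem_iff.2 fun h => hbm ?_)) hb
    exact hΛ.dia_mem_mono (fun k hk => by simpa only [neg_mem_iff, not_not] using hk) h
  · exact not_not.1 fun h => han (hn.neg_mem_iff.2 h)

theorem holds_iff_mem (hΛ : IsNormalLogic Λ) : (canonicalModel Λ).Holds m a ↔ a ∈ m := by
  induction a generalizing m with
  | var n => exact Iff.rfl
  | bot => exact iff_of_false id m.isBoolean.bot_notMem
  | imp a b iha ihb => exact (imp_congr iha ihb).trans imp_mem_iff.symm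
  | dia a ih =>
    refine ⟨fun ⟨n, hmn, hn⟩ => hmn a (ih.1 hn), fun ha => ?_⟩
    obtain ⟨n, hmn, han⟩ := exists_rel_of_dia_mem hΛ ha
    exact ⟨n, hmn, ih.2 han⟩

theorem isPreorder_rel (hΛ : IsNormalLogic Λ) (hS4 : logicS4 ⊆ Λ) :
    IsPreorder (CanonicalPoint Λ) (canonicalModel Λ).rel where
  refl _ a := mem_of_imp_mem (hΛ.imp_dia_mem hS4 a)
  trans _ _ _ hmn hnk a ha := mem_of_imp_mem (hΛ.dia_dia_imp_dia_mem hS4 a) (hmn _ (hnk a ha))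

theorem box_box_mem (hΛ : IsNormalLogic Λ) (hS4 : logicS4 ⊆ Λ) (ha : box a ∈ m) :
    box (box a) ∈ m := by
  refine m.isBoolean.box_mem_iff.2 fun h => m.isBoolean.box_mem_iff.1 ha ?_
  refine mem_of_imp_mem (hΛ.dia_dia_imp_dia_mem hS4 (neg a)) (hΛ.dia_mem_mono (fun n hn => ?_) h)
  simpa only [box, neg_mem_iff, not_not] using hn

variable (hΛ : IsNormalLogic Λ) (hS421 : logicS421 ⊆ Λ)
include hΛ hS421

theorem box_dia_mem_iff_dia_box_mem : box (dia a) ∈ m ↔ dia (box a) ∈ m :=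
  m.isBoolean.iff_mem_iff.1 (m.mem_of_mem (hΛ.iff_box_dia_dia_box_mem hS421 a))

theorem dia_box_box_mem (ha : dia (box a) ∈ m) : dia (box (box a)) ∈ m :=
  hΛ.dia_mem_mono (fun _ => box_box_mem hΛ (logicS4_subset_logicS421.trans hS421)) ha

theorem dia_box_neg_mem_iff : dia (box (neg a)) ∈ m ↔ dia (box a) ∉ m :=
  (box_dia_mem_iff_dia_box_mem hΛ hS421).symm.trans neg_mem_iff

theorem isTheory_setOf_dia_box_mem (m : CanonicalPoint Λ) : IsTheory {a | dia (box a) ∈ m} where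
  tautology a ha := mem_of_imp_mem (hΛ.imp_dia_mem (logicS4_subset_logicS421.trans hS421) _) <|
    hΛ.box_mem_of_forall fun n => n.mem_of_mem (hΛ.tautology a ha)
  modus_ponens a b ha hab := by
    obtain ⟨n, hmn, hn⟩ := exists_rel_of_dia_mem hΛ ha
    have hab' : dia (box (imp a b)) ∈ n := mem_of_rel_of_box_mem hmn <|
      (box_dia_mem_iff_dia_box_mem hΛ hS421).2 (dia_box_box_mem hΛ hS421 hab)
    have hS4 := logicS4_subset_logicS421.trans hS421
    obtain ⟨k, hnk, hk⟩ := exists_rel_of_dia_mem hΛ hab'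
    have hak : box a ∈ k := mem_of_rel_of_box_mem hnk (box_box_mem hΛ hS4 hn)
    have hmk : (canonicalModel Λ).rel m k := (isPreorder_rel hΛ hS4).trans _ _ _ hmn hnk
    exact hmk _ ((hΛ.isTheory_setOf_box_mem k).modus_ponens a b hak hk)

/-- By `□◇ ↔ ◇□`, each formula or its negation is eventually always true above `m`, and the
eventually always true formulas make up the final point. -/
theorem exists_final (m : CanonicalPoint Λ) :
    ∃ k, (∀ n, (canonicalModel Λ).rel m n → (canonicalModel Λ).rel n k) ∧
      ∀ n, (canonicalModel Λ).rel k n → n = k := by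
  have hS4 := logicS4_subset_logicS421.trans hS421
  let k : CanonicalPoint Λ := ⟨{a | dia (box a) ∈ m},
    (isTheory_setOf_dia_box_mem hΛ hS421 m).isBoolean fun _ => dia_box_neg_mem_iff hΛ hS421,
    fun a ha => mem_of_imp_mem (hΛ.imp_dia_mem hS4 _) <|
      hΛ.box_mem_of_forall fun n => n.mem_of_mem ha⟩
  refine ⟨k, fun n hmn a (ha : dia (box a) ∈ m) => ?_, fun n hkn => ?_⟩
  · exact mem_of_rel_of_box_mem hmn ((box_dia_mem_iff_dia_box_mem hΛ hS421).2 ha)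
  · refine (eq_of_forall_mem fun a ha => ?_).symm
    have hbox : box a ∈ k := dia_box_box_mem hΛ hS421 ha
    exact mem_of_rel_of_box_mem hkn hbox

end CanonicalPoint

theorem IsNormalLogic.mem_of_forall_treeModel {Λ : Set ModalFormula} {c : Prop} {a : ModalFormula}
    (hΛ : IsNormalLogic Λ) (hS4 : logicS4 ⊆ Λ) (hS421 : c → logicS421 ⊆ Λ)
    (h : ∀ V, (treeModel c V).Holds (some []) a) : a ∈ Λ := by
  refine hΛ.mem_iff_forall_canonicalPoint.2 fun m => ?_
  have := CanonicalPoint.isPreorder_rel hΛ hS4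
  obtain ⟨V, hV⟩ := (canonicalModel Λ).exists_treeModel_holds_iff m fun hc =>
    CanonicalPoint.exists_final hΛ (hS421 hc) m
  exact (CanonicalPoint.holds_iff_mem hΛ).1 ((hV a).1 (h V))

/-! ### The modal theory of a relation between models -/

open FirstOrder FirstOrder.Language

namespace ModelTheoreticLanguage

section Relation

variable {Ω : FirstOrder.Language.{u, v}} {L : ModelTheoreticLanguage.{u, v, w, s} Ω}
  {f : L.Sent → L.Sent} {C : Set (SigModel.{u, v, w} Ω)}
  {R : SigModel.{u, v, w} Ω → SigModel.{u, v, w} Ω → Prop} {a : ModalFormula}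

/-- The Kripke model on a class `C` of models of `Ω` with the accessibility relation `R`, where the
variables are evaluated by sentences of `L`. -/
def kripkeModel (L : ModelTheoreticLanguage.{u, v, w, s} Ω) (C : Set (SigModel.{u, v, w} Ω))
    (R : SigModel.{u, v, w} Ω → SigModel.{u, v, w} Ω → Prop) (θ : ℕ → L.Sent) : KripkeModel C where
  rel A B := R A B
  val n A := L.Sat A (θ n)

theorem not_sat_bot (A : SigModel.{u, v, w} Ω) : ¬ L.Sat A L.bot :=
  (L.sat_ofFirstOrder A ⊥).not.2 id

theorem sat_extend_iff_holds (hf : L.Expresses f C R) (θ : ℕ → L.Sent) (A : C) :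
    L.Sat A (L.extend f θ a) ↔ (kripkeModel L C R θ).Holds A a := by
  induction a generalizing A with
  | var n => exact Iff.rfl
  | bot => exact iff_of_false (not_sat_bot _) id
  | imp a b iha ihb => exact (L.sat_imp _ _ _).trans (imp_congr (iha A) (ihb A))
  | dia a ih =>
    rw [extend, hf _ A A.2]
    exact ⟨fun ⟨B, hB, hAB, h⟩ => ⟨⟨B, hB⟩, hAB, (ih ⟨B, hB⟩).1 h⟩,
      fun ⟨B, hAB, h⟩ => ⟨B, B.2, hAB, (ih B).2 h⟩⟩

theorem mem_modalTheory_iff_forall_holds (hf : L.Expresses f C R) :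
    a ∈ L.modalTheory (L.theoryOf C) f ↔ ∀ θ A, (kripkeModel L C R θ).Holds A a :=
  forall_congr' fun θ => Subtype.forall'.trans <|
    forall_congr' fun A => sat_extend_iff_holds hf θ A

theorem extend_subst (f : L.Sent → L.Sent) (θ : ℕ → L.Sent) (σ : ℕ → ModalFormula)
    (a : ModalFormula) :
    L.extend f θ (subst σ a) = L.extend f (fun n => L.extend f θ (σ n)) a := by
  induction a with
  | var n => rfl
  | bot => rfl
  | imp a b iha ihb => simp only [subst, extend, iha, ihb]
  | dia a ih => simp only [subst, extend, ih]

theorem isNormalLogic_modalTheory (hf : L.Expresses f C R) :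
    IsNormalLogic (L.modalTheory (L.theoryOf C) f) where
  tautology a ha := (mem_modalTheory_iff_forall_holds hf).2 fun θ A =>
    isTautology_iff.1 ha _ ((kripkeModel L C R θ).isBoolean_setOf_holds A)
  dia_bot := (mem_modalTheory_iff_forall_holds hf).2 fun _ _ ⟨_, _, h⟩ => h
  dia_or := (mem_modalTheory_iff_forall_holds hf).2 fun _ _ ⟨B, hAB, h⟩ =>
    KripkeModel.holds_or.2 <| (KripkeModel.holds_or.1 h).imp (⟨B, hAB, ·⟩) (⟨B, hAB, ·⟩)
  modus_ponens a b := by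
    simp only [mem_modalTheory_iff_forall_holds hf]
    exact fun ha hab θ A => hab θ A (ha θ A)
  substitution a ha σ θ := extend_subst f θ σ a ▸ ha _
  monotonicity a b := by
    simp only [mem_modalTheory_iff_forall_holds hf]
    exact fun hab θ _ ⟨B, hAB, h⟩ => ⟨B, hAB, hab θ B h⟩

theorem logicS4_subset_modalTheory [IsPreorder _ R] (hf : L.Expresses f C R) :
    logicS4 ⊆ L.modalTheory (L.theoryOf C) f := by
  refine leastNormalLogic_subset (isNormalLogic_modalTheory hf) ?_
  rintro _ (rfl | rfl) <;> refine (mem_modalTheory_iff_forall_holds hf).2 fun θ A => ?_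
  · rintro ⟨B, hAB, D, hBD, hD⟩
    exact ⟨D, _root_.trans (r := R) hAB hBD, hD⟩
  · exact fun h => ⟨A, refl (r := R) _, h⟩

end Relation

end ModelTheoreticLanguage

/-! ### The submodel relation -/

section ContainsSubmodel

variable {Ω : FirstOrder.Language.{u, v}}

theorem containsSubmodel_iff {A B : SigModel.{u, v, w} Ω} :
    ContainsSubmodel A B ↔ Nonempty (B ↪[Ω] A) :=
  ⟨fun ⟨S, ⟨e⟩⟩ => ⟨S.subtype.comp e.toEmbedding⟩, fun ⟨e⟩ => ⟨_, ⟨e.equivRange⟩⟩⟩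

instance : IsPreorder (SigModel.{u, v, w} Ω) ContainsSubmodel where
  refl A := containsSubmodel_iff.2 ⟨Embedding.refl Ω A⟩
  trans A B D hAB hBD := by
    rw [containsSubmodel_iff] at *
    exact hAB.elim fun e => hBD.map e.comp

theorem exists_least_submodel [Nonempty Ω.Constants] (A : SigModel.{u, v, w} Ω) :
    ∃ M : SigModel.{u, v, w} Ω, (∀ B, ContainsSubmodel A B → ContainsSubmodel B M) ∧
      ∀ B, ContainsSubmodel M B → Nonempty (B ≃[Ω] M) := by
  have : Nonempty (⊥ : Ω.Substructure A) :=
    ‹Nonempty Ω.Constants›.map fun c => ⟨_, Substructure.constants_mem c⟩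
  refine ⟨Theory.ModelType.of ∅ (⊥ : Ω.Substructure A), ?_, ?_⟩
  · rintro B ⟨S, ⟨e⟩⟩
    exact containsSubmodel_iff.2 ⟨e.symm.toEmbedding.comp (Substructure.inclusion bot_le)⟩
  · rintro B ⟨S, ⟨e⟩⟩
    obtain rfl : S = ⊤ := by
      refine top_le_iff.1 fun x _ => ?_
      obtain ⟨y, hy, hyx⟩ := (bot_le : _ ≤ S.map (⊥ : Ω.Substructure A).subtype.toHom) x.2
      exact Subtype.ext hyx ▸ hy
    exact ⟨Substructure.topEquiv.comp e⟩

theorem ModelTheoreticLanguage.logicS421_subset_modalTheory [Nonempty Ω.Constants]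
    {L : ModelTheoreticLanguage.{u, v, w, s} Ω} {f : L.Sent → L.Sent}
    (hf : L.Expresses f Set.univ ContainsSubmodel) :
    logicS421 ⊆ L.modalTheory (L.theoryOf Set.univ) f := by
  refine leastNormalLogic_subset (isNormalLogic_modalTheory hf) <|
    Set.union_subset (logicS4_subset_modalTheory hf) ?_
  rintro _ rfl
  refine (mem_modalTheory_iff_forall_holds hf).2 fun θ A => ?_
  obtain ⟨M, hAM, hM⟩ := exists_least_submodel A.1
  have hwk : (kripkeModel L Set.univ ContainsSubmodel θ).rel A ⟨M, trivial⟩ := hAM A (refl A.1)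
  refine KripkeModel.holds_iff_box_dia_dia_box hwk (fun B => hAM B) fun B hMB => ?_
  obtain ⟨e⟩ := hM B hMB
  exact ⟨L.sat_of_equiv _ _ e _, L.sat_of_equiv _ _ e.symm _⟩

end ContainsSubmodel

/-! ### A multiplication on the tree whose submagmas are the cones -/

open Classical in
/-- The product of the node `x` with the node `z ++ x` of the cone above it. The products with `x`
and with the children of `x` yield all children of `x`, and the product with `0 :: j :: x` tells
whether `b x j`. -/
noncomputable def climb (b : List ℕ → ℕ → Prop) (x : List ℕ) : List ℕ → List ℕ
  | [] => 0 :: x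
  | [j] => (j + 1) :: x
  | [0, j] => if b x j then x else 0 :: x
  | _ => x

open Classical in
/-- A multiplication on the tree of finite sequences for which the nonempty closed sets are the
cones. The predicate `b` labels the nodes by sets of numbers. -/
noncomputable def treeMul (b : List ℕ → ℕ → Prop) (x y : List ℕ) : List ℕ :=
  if x <:+ y then climb b x (y.take (y.length - x.length)) else if y <:+ x then y else x.tail

section treeMul

variable (b : List ℕ → ℕ → Prop) {x y z : List ℕ}

theorem suffix_climb (x z : List ℕ) : x <:+ climb b x z := by
  unfold climb
  split <;> try split_ifs
  all_goals first | exact List.suffix_rfl | exact List.suffix_cons _ _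

theorem treeMul_append (x z : List ℕ) : treeMul b x (z ++ x) = climb b x z := by
  simp [treeMul]

theorem treeMul_self (x : List ℕ) : treeMul b x x = 0 :: x :=
  treeMul_append b x []

theorem treeMul_cons (x : List ℕ) (j : ℕ) : treeMul b x (j :: x) = (j + 1) :: x :=
  treeMul_append b x [j]

theorem treeMul_zero_cons_cons_eq_self_iff {j : ℕ} :
    treeMul b x (0 :: j :: x) = x ↔ b x j := by
  rw [show 0 :: j :: x = [0, j] ++ x from rfl, treeMul_append, climb]
  simp

theorem treeMul_eq_right (h : x <:+ y) (hne : y ≠ x) : treeMul b y x = x := by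
  rw [treeMul, if_neg fun h' => hne (h'.eq_of_length (h'.length_le.antisymm h.length_le)), if_pos h]

theorem treeMul_eq_tail (hxy : ¬ x <:+ y) (hyx : ¬ y <:+ x) : treeMul b x y = x.tail := by
  rw [treeMul, if_neg hxy, if_neg hyx]

theorem suffix_treeMul (hx : z <:+ x) (hy : z <:+ y) : z <:+ treeMul b x y := by
  by_cases hxy : x <:+ y
  · obtain ⟨t, rfl⟩ := hxy
    exact treeMul_append b x t ▸ hx.trans (suffix_climb b x t)
  by_cases hyx : y <:+ x
  · rwa [treeMul_eq_right b hyx fun h => hxy (h ▸ List.suffix_rfl)]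
  rw [treeMul_eq_tail b hxy hyx]
  cases x with
  | nil => exact hx
  | cons i x => exact (List.suffix_cons_iff.1 hx).resolve_left fun h => hxy (h ▸ hy)

theorem exists_eq_setOf_suffix {S : Set (List ℕ)} (hne : S.Nonempty)
    (hS : ∀ x ∈ S, ∀ y ∈ S, treeMul b x y ∈ S) : ∃ x, S = {y | x <:+ y} := by
  obtain ⟨x, hx, hmin⟩ := exists_minimalFor_of_wellFoundedLT (· ∈ S) List.length hne
  refine ⟨x, Set.ext fun y => ⟨fun hy => ?_, ?_⟩⟩
  · by_contra hxy
    have hyx : ¬ y <:+ x := fun h =>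
      hxy (h.eq_of_length (h.length_le.antisymm (hmin hy h.length_le)) ▸ List.suffix_rfl)
    have hxne : x ≠ [] := fun h => hxy (h ▸ y.nil_suffix)
    have htail : x.tail ∈ S := treeMul_eq_tail b hxy hyx ▸ hS x hx y hy
    have := hmin htail (by simp)
    have := List.length_pos_iff.2 hxne
    grind
  · rintro ⟨z, rfl⟩
    induction z with
    | nil => exact hx
    | cons i z ih =>
      induction i with
      | zero => simpa [treeMul_self] using hS _ ih _ ih
      | succ j hj => simpa [treeMul_cons] using hS _ ih _ hj

end treeMul

/-- An element that absorbs every other element from the left. In a cone of the tree, this is the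
root. -/
def IsRoot {M : Type*} (mul : M → M → M) (r : M) : Prop :=
  ∀ y, y = r ∨ mul y r = r

/-- The magma `M` has a root `r` with `r * (x * x) = r`, where `x = r * (r * ⋯ * (r * r))` is the
`j`-th child of the root if `M` is a cone of the tree. -/
def RootProperty {M : Type*} (mul : M → M → M) (j : ℕ) : Prop :=
  ∃ r, IsRoot mul r ∧ mul r (mul ((mul r)^[j + 1] r) ((mul r)^[j + 1] r)) = r

theorem rootProperty_of_subsingleton {M : Type*} [Nonempty M] [Subsingleton M] (mul : M → M → M)
    (j : ℕ) : RootProperty mul j :=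
  ⟨Classical.arbitrary M, fun _ => .inl (Subsingleton.elim _ _), Subsingleton.elim _ _⟩

section Cone

variable {M : Type*} {mul : M → M → M} {b : List ℕ → ℕ → Prop} {g : M → Option (List ℕ)}
  (hg : Function.Injective g)
  (hmul : ∀ y z, g (mul y z) = Option.merge (treeMul b) (g y) (g z)) {x : List ℕ} {c : Prop}
  (hrange : Set.range g = {q | treeRel c (some x) q})

include hmul in
theorem map_iterate_mul {r : M} (hr : g r = some x) (j : ℕ) :
    g ((mul r)^[j + 1] r) = some (j :: x) := by
  induction j with
  | zero => simp [hmul, hr, treeMul_self]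
  | succ j ih => rw [Function.iterate_succ_apply', hmul, hr, ih, Option.merge, treeMul_cons]

include hg hmul hrange

theorem isRoot_iff_of_range_eq {r : M} : IsRoot mul r ↔ g r = some x := by
  have hmem (y : List ℕ) : (∃ z, g z = some y) ↔ x <:+ y := Set.ext_iff.1 hrange (some y)
  simp only [IsRoot, ← hg.eq_iff, hmul]
  constructor
  · intro hr
    cases hgr : g r with
    | none =>
      obtain ⟨r₀, hr₀⟩ := (hmem x).2 List.suffix_rfl
      simpa [hgr, hr₀] using hr r₀
    | some y =>
      obtain ⟨z, rfl⟩ := (hmem y).1 ⟨r, hgr⟩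
      cases z with
      | nil => rfl
      | cons i z =>
        obtain ⟨parent, hparent⟩ := (hmem (z ++ x)).2 (List.suffix_append z x)
        simpa [hgr, hparent, treeMul_cons] using hr parent
  · intro hr y
    rw [hr]
    cases hy : g y with
    | none => exact .inr rfl
    | some y =>
      refine or_iff_not_imp_left.2 fun hne => congrArg some (treeMul_eq_right b ?_ ?_)
      · exact (hmem y).1 ⟨_, hy⟩
      · exact fun h => hne (congrArg some h)

theorem rootProperty_iff_of_range_eq (j : ℕ) : RootProperty mul j ↔ b x j := by
  obtain ⟨r, hr⟩ : some x ∈ Set.range g := hrange ▸ treeRel_refl (c := c) (some x)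
  have htest : mul r (mul ((mul r)^[j + 1] r) ((mul r)^[j + 1] r)) = r ↔ b x j := by
    rw [← hg.eq_iff, hmul, hmul, map_iterate_mul hmul hr, hr, Option.merge, Option.merge,
      treeMul_self, Option.some_inj, treeMul_zero_cons_cons_eq_self_iff]
  have hroot (r' : M) : IsRoot mul r' ↔ r' = r := by
    rw [isRoot_iff_of_range_eq hg hmul hrange, ← hr, hg.eq_iff]
  simp only [RootProperty, hroot, exists_eq_left, htest]

end Cone

/-! ### A structure on the tree whose submodels are the cones -/

section BinaryMap

variable {Ω : FirstOrder.Language.{u, v}} {n : ℕ}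

/-- The binary operation `F(x, y, …, y)` given by a function symbol `F`. -/
def binaryMap (F : Ω.Functions n) {M : Type*} [Ω.Structure M] (x y : M) : M :=
  Structure.funMap F fun i => if i.val = 0 then x else y

theorem binaryMap_mem (F : Ω.Functions n) {M : Type*} [Ω.Structure M] {S : Ω.Substructure M}
    {x y : M} (hx : x ∈ S) (hy : y ∈ S) : binaryMap F x y ∈ S :=
  S.fun_mem F _ fun i => by
    split_ifs
    exacts [hx, hy]

theorem map_binaryMap (F : Ω.Functions n) {M N : Type*} [Ω.Structure M] [Ω.Structure N]
    (e : M ↪[Ω] N) (x y : M) : e (binaryMap F x y) = binaryMap F (e x) (e y) := by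
  simp only [binaryMap, e.map_fun, Function.comp_def, apply_ite e]

/-- The term `F(t₁, t₂, …, t₂)`, which expresses the operation `binaryMap F`. -/
def binaryTerm (F : Ω.Functions n) {α : Type*} (t₁ t₂ : Ω.Term α) : Ω.Term α :=
  .func F fun i => if i.val = 0 then t₁ else t₂

theorem realize_binaryTerm (F : Ω.Functions n) {α M : Type*} [Ω.Structure M] (t₁ t₂ : Ω.Term α)
    (x : α → M) :
    (binaryTerm F t₁ t₂).realize x = binaryMap F (t₁.realize x) (t₂.realize x) := by
  simp only [binaryTerm, binaryMap, Term.realize, apply_ite (Term.realize x)]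

theorem realize_iterate_binaryTerm (F : Ω.Functions n) {α M : Type*} [Ω.Structure M]
    (t : Ω.Term α) (x : α → M) (j : ℕ) :
    ((binaryTerm F t)^[j] t).realize x = (binaryMap F (t.realize x))^[j] (t.realize x) :=
  (Function.Semiconj.iterate_right (f := Term.realize x) (realize_binaryTerm F t · x) j) t

/-- The first-order sentence that expresses `RootProperty (binaryMap F) j`. -/
def rootSentence (F : Ω.Functions n) (j : ℕ) : Ω.Sentence :=
  let r₁ : Ω.Term (Empty ⊕ Fin 1) := .var (.inr 0)
  let r₂ : Ω.Term (Empty ⊕ Fin 2) := .var (.inr 0)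
  let y : Ω.Term (Empty ⊕ Fin 2) := .var (.inr 1)
  let child := (binaryTerm F r₁)^[j + 1] r₁
  let isRoot := BoundedFormula.all (n := 1) ((y.bdEqual r₂) ⊔ ((binaryTerm F y r₂).bdEqual r₂))
  BoundedFormula.ex (n := 0)
    (isRoot ⊓ ((binaryTerm F r₁ (binaryTerm F child child)).bdEqual r₁))

theorem realize_rootSentence (F : Ω.Functions n) (j : ℕ) (M : Type*) [Ω.Structure M] :
    M ⊨ rootSentence F j ↔ RootProperty (binaryMap F : M → M → M) j := by
  simp [rootSentence, Sentence.Realize, Formula.Realize, RootProperty, IsRoot,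
    realize_binaryTerm, realize_iterate_binaryTerm, Fin.snoc, -Function.iterate_succ]

end BinaryMap

theorem treeRel_merge_treeMul {c : Prop} (b : List ℕ → ℕ → Prop) :
    ∀ {p q q' : Option (List ℕ)}, treeRel c p q → treeRel c p q' →
      treeRel c p (Option.merge (treeMul b) q q')
  | some _, some _, some _, hq, hq' => suffix_treeMul b hq hq'
  | some _, some _, none, hq, _ => hq
  | some _, none, some _, _, hq' => hq'
  | some _, none, none, hq, _ => hq
  | none, none, none, _, _ => trivial

/-- The tree with an endpoint as the universe of a structure: the function symbols of arity at least
`2` multiply their first two arguments, with the endpoint as a neutral element, those of arity `1`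
are the identity, and the constants are the endpoint. -/
@[ext]
structure TreeStructure (b : List ℕ → ℕ → Prop) : Type w where
  point : Option (List ℕ)

namespace TreeStructure

variable {Ω : FirstOrder.Language.{u, v}} {b : List ℕ → ℕ → Prop} {p q : Option (List ℕ)}

noncomputable instance : Ω.Structure (TreeStructure.{w} b) where
  funMap {n} _ x := match n, x with
    | 0, _ => ⟨none⟩
    | 1, x => x 0
    | _ + 2, x => ⟨Option.merge (treeMul b) (x 0).point (x 1).point⟩
  RelMap _ _ := False

theorem binaryMap_eq {n : ℕ} (hn : 2 ≤ n) (F : Ω.Functions n) (x y : TreeStructure.{w} b) :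
    binaryMap F x y = ⟨Option.merge (treeMul b) x.point y.point⟩ := by
  obtain ⟨n, rfl⟩ := Nat.exists_eq_add_of_le' hn
  rfl

/-- The substructure of the points that are accessible from `p`. -/
def cone (Ω : FirstOrder.Language.{u, v}) (b : List ℕ → ℕ → Prop) (p : Option (List ℕ)) :
    Ω.Substructure (TreeStructure.{w} b) where
  carrier := {q | treeRel (Nonempty Ω.Constants) p q.point}
  fun_mem {n} F x hx := match n, F, x, hx with
    | 0, F, _, _ => treeRel_none ⟨F⟩ p
    | 1, _, _, hx => hx 0
    | _ + 2, _, _, hx => treeRel_merge_treeMul b (hx 0) (hx 1)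

theorem mem_cone {q : TreeStructure.{w} b} :
    q ∈ cone Ω b p ↔ treeRel (Nonempty Ω.Constants) p q.point :=
  Iff.rfl

theorem cone_le_cone (hpq : treeRel (Nonempty Ω.Constants) p q) :
    cone Ω b q ≤ (cone Ω b p : Ω.Substructure (TreeStructure.{w} b)) :=
  fun _ => treeRel_trans hpq

theorem exists_eq_cone {n : ℕ} (hn : 2 ≤ n) (F : Ω.Functions n)
    {S : Ω.Substructure (TreeStructure.{w} b)} (hne : (S : Set (TreeStructure.{w} b)).Nonempty)
    (hS : S ≤ cone Ω b p) : ∃ q, treeRel (Nonempty Ω.Constants) p q ∧ S = cone Ω b q := by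
  let T : Set (List ℕ) := {y | (⟨some y⟩ : TreeStructure b) ∈ S}
  have hT : ∀ y ∈ T, ∀ z ∈ T, treeMul b y z ∈ T := fun y hy z hz => by
    have hmem := binaryMap_mem F (S := S) hy hz
    rwa [binaryMap_eq hn] at hmem
  obtain ⟨q, hq⟩ := hne
  rcases T.eq_empty_or_nonempty with hempty | hTne
  · have hnone : ∀ r ∈ S, r.point = none := fun r hr =>
      Option.eq_none_iff_forall_ne_some.2 fun y hy => hempty.subset <|
        show (⟨some y⟩ : TreeStructure b) ∈ S by rwa [← hy]
    refine ⟨none, hnone q hq ▸ hS hq, SetLike.ext fun r => ?_⟩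
    rw [mem_cone, treeRel_none_left]
    refine ⟨hnone r, fun hr => ?_⟩
    rwa [show r = q from TreeStructure.ext (hr.trans (hnone q hq).symm)]
  · obtain ⟨x, hx⟩ := exists_eq_setOf_suffix b hTne hT
    have hmem (y : List ℕ) : (⟨some y⟩ : TreeStructure b) ∈ S ↔ x <:+ y := Set.ext_iff.1 hx y
    have hpx := hS ((hmem x).2 List.suffix_rfl)
    refine ⟨some x, hpx, SetLike.ext fun ⟨r⟩ => ?_⟩
    cases r with
    | some y => exact hmem y
    | none =>
      refine ⟨fun hr => ?_, fun ⟨d⟩ => Substructure.constants_mem (S := S) d⟩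
      cases p with
      | some _ => exact hS hr
      | none => exact hpx.elim

/-- The cone of `p` as a model of the signature `Ω`. -/
noncomputable def coneModel (Ω : FirstOrder.Language.{u, v}) (b : List ℕ → ℕ → Prop)
    (p : Option (List ℕ)) : SigModel.{u, v, w} Ω :=
  have : Nonempty (cone Ω b p) := ⟨⟨⟨p⟩, treeRel_refl p⟩⟩
  Theory.ModelType.of ∅ (cone Ω b p)

theorem containsSubmodel_coneModel_iff {n : ℕ} (hn : 2 ≤ n) (F : Ω.Functions n)
    {B : SigModel.{u, v, w} Ω} :
    ContainsSubmodel (coneModel Ω b p) B ↔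
      ∃ q, treeRel (Nonempty Ω.Constants) p q ∧ Nonempty (B ≃[Ω] coneModel.{u, v, w} Ω b q) := by
  rw [containsSubmodel_iff]
  constructor
  · rintro ⟨e⟩
    let e' : B ↪[Ω] TreeStructure.{w} b := (cone Ω b p).subtype.comp e
    have hle : e'.toHom.range ≤ cone Ω b p := by
      rintro _ ⟨x, rfl⟩
      exact (e x).2
    obtain ⟨q, hpq, hq⟩ := exists_eq_cone hn F (Set.range_nonempty e') hle
    have equivRange : Nonempty (B ≃[Ω] e'.toHom.range) := ⟨e'.equivRange⟩
    rw [hq] at equivRange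
    exact ⟨q, hpq, equivRange⟩
  · rintro ⟨q, hpq, ⟨e⟩⟩
    exact ⟨(Substructure.inclusion (cone_le_cone hpq)).comp e.toEmbedding⟩

theorem rootProperty_cone_some_iff {n : ℕ} (hn : 2 ≤ n) (F : Ω.Functions n) (x : List ℕ) (j : ℕ) :
    RootProperty (binaryMap F (M := (cone Ω b (some x) : Ω.Substructure (TreeStructure.{w} b)))) j ↔
      b x j := by
  refine rootProperty_iff_of_range_eq (g := fun z => z.1.point) (c := Nonempty Ω.Constants)
    (fun y z h => Subtype.ext (TreeStructure.ext h)) (fun y z => ?_) ?_ j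
  · exact congrArg point
      ((map_binaryMap F (cone Ω b (some x)).subtype y z).trans (binaryMap_eq hn F _ _))
  · ext q
    exact ⟨fun ⟨z, hz⟩ => hz ▸ z.2, fun hq => ⟨⟨⟨q⟩, hq⟩, rfl⟩⟩

theorem rootProperty_cone_none {n : ℕ} (F : Ω.Functions n) (j : ℕ) :
    RootProperty (binaryMap F (M := (cone Ω b none : Ω.Substructure (TreeStructure.{w} b)))) j := by
  have : Nonempty (cone Ω b none : Ω.Substructure (TreeStructure.{w} b)) := ⟨⟨none⟩, trivial⟩
  have : Subsingleton (cone Ω b none : Ω.Substructure (TreeStructure.{w} b)) :=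
    ⟨fun y z => Subtype.ext <| TreeStructure.ext <|
      (treeRel_none_left.1 y.2).trans (treeRel_none_left.1 z.2).symm⟩
  exact rootProperty_of_subsingleton _ j

end TreeStructure

namespace ModelTheoreticLanguage

variable {Ω : FirstOrder.Language.{u, v}} {L : ModelTheoreticLanguage.{u, v, w, s} Ω} {n : ℕ}
  {F : Ω.Functions n} {V : ℕ → Option (List ℕ) → Prop} {p : Option (List ℕ)} {a : ModalFormula}

/-- The labels of the nodes of the tree which tell apart the truth values of the variables at a node
and at the endpoint, where the submodels of the endpoint always have the root property. -/
def treeLabel (V : ℕ → Option (List ℕ) → Prop) (x : List ℕ) (j : ℕ) : Prop :=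
  V j (some x) ↔ V j none

open Classical in
/-- The sentences that define the valuation `V` on the cones of the tree labeled by `treeLabel V`:
the root property, negated if the variable is false at the endpoint. -/
noncomputable def treeValuation (L : ModelTheoreticLanguage.{u, v, w, s} Ω) (F : Ω.Functions n)
    (V : ℕ → Option (List ℕ) → Prop) (j : ℕ) : L.Sent :=
  L.ofFirstOrder (if V j none then rootSentence F j else ∼(rootSentence F j))

theorem sat_treeValuation_iff (A : SigModel.{u, v, w} Ω) (j : ℕ) :
    L.Sat A (treeValuation L F V j) ↔
      (RootProperty (binaryMap F : A → A → A) j ↔ V j none) := by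
  rw [treeValuation, L.sat_ofFirstOrder]
  split_ifs with h
  · simp [realize_rootSentence, h]
  · simp [Sentence.realize_not, realize_rootSentence, h]

theorem sat_treeValuation_coneModel_iff (hn : 2 ≤ n) (j : ℕ) :
    L.Sat (TreeStructure.coneModel Ω (treeLabel V) p) (treeValuation L F V j) ↔ V j p := by
  rw [sat_treeValuation_iff]
  cases p with
  | none => exact iff_true_left (TreeStructure.rootProperty_cone_none F j)
  | some x =>
    refine (iff_congr (TreeStructure.rootProperty_cone_some_iff hn F x j) Iff.rfl).trans ?_
    rw [treeLabel]
    tauto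

theorem isBisimulation_treeModel (hn : 2 ≤ n) :
    (kripkeModel L Set.univ ContainsSubmodel (treeValuation L F V)).IsBisimulation
      (treeModel (Nonempty Ω.Constants) V)
      fun A p => Nonempty (A.1 ≃[Ω] TreeStructure.coneModel.{u, v, w} Ω (treeLabel V) p) where
  val_iff := by
    rintro A p ⟨e⟩ j
    exact Iff.trans ⟨L.sat_of_equiv _ _ e _, L.sat_of_equiv _ _ e.symm _⟩
      (sat_treeValuation_coneModel_iff (L := L) (F := F) hn j)
  forth := by
    rintro A p B ⟨e⟩ hAB
    obtain ⟨g⟩ := containsSubmodel_iff.1 hAB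
    exact (TreeStructure.containsSubmodel_coneModel_iff hn F).1
      (containsSubmodel_iff.2 ⟨e.toEmbedding.comp g⟩)
  back := by
    rintro A p q ⟨e⟩ hpq
    obtain ⟨g⟩ := containsSubmodel_iff.1 <|
      (TreeStructure.containsSubmodel_coneModel_iff hn F).2 ⟨q, hpq, ⟨.refl Ω _⟩⟩
    exact ⟨⟨_, trivial⟩, containsSubmodel_iff.2 ⟨e.symm.toEmbedding.comp g⟩, ⟨.refl Ω _⟩⟩

theorem treeModel_holds_of_mem_modalTheory {f : L.Sent → L.Sent}
    (hf : L.Expresses f Set.univ ContainsSubmodel)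
    (hΩ : ∃ n : ℕ, 2 ≤ n ∧ Nonempty (Ω.Functions n))
    (ha : a ∈ L.modalTheory (L.theoryOf Set.univ) f) (V : ℕ → Option (List ℕ) → Prop)
    (p : Option (List ℕ)) : (treeModel (Nonempty Ω.Constants) V).Holds p a := by
  obtain ⟨n, hn, ⟨F⟩⟩ := hΩ
  exact ((isBisimulation_treeModel hn).holds_iff (w := ⟨_, trivial⟩) ⟨.refl Ω _⟩ a).1 <|
    (mem_modalTheory_iff_forall_holds hf).1 ha (treeValuation L F V) _

end ModelTheoreticLanguage

open ModelTheoreticLanguage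

theorem mainTheorem1
    (Ω : FirstOrder.Language.{u, v})
    (hΩ : ∃ n : ℕ, 2 ≤ n ∧ Nonempty (Ω.Functions n))
    (L : ModelTheoreticLanguage.{u, v, w, s} Ω)
    (f : L.Sent → L.Sent)
    (hf : L.Expresses f Set.univ ContainsSubmodel) :
    (IsEmpty Ω.Constants → L.modalTheory (L.theoryOf Set.univ) f = logicS4) ∧
    (Nonempty Ω.Constants → L.modalTheory (L.theoryOf Set.univ) f = logicS421) := by
  refine ⟨fun hconst => Set.Subset.antisymm (fun a ha => ?_) (logicS4_subset_modalTheory hf),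
    fun hconst => Set.Subset.antisymm (fun a ha => ?_) (logicS421_subset_modalTheory hf)⟩
  · have hS421 (h : Nonempty Ω.Constants) : logicS421 ⊆ logicS4 :=
      (not_nonempty_iff.2 hconst h).elim
    exact (isNormalLogic_leastNormalLogic _).mem_of_forall_treeModel subset_rfl hS421
      fun V => treeModel_holds_of_mem_modalTheory hf hΩ ha V _
  · have hS421 (_ : Nonempty Ω.Constants) : logicS421 ⊆ logicS421 := subset_rfl
    exact (isNormalLogic_leastNormalLogic _).mem_of_forall_treeModel logicS4_subset_logicS421 hS421
      fun V => treeModel_holds_of_mem_modalTheory hf hΩ ha V _
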